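/- Throughout, $\mathbb{N}=\{1,2,3,\dots\}$ and rings are associative with identity. Let $S$ be a ring and $m\in\mathbb{N}$. An element $r\in S$ has an *$m$-torsion clean decomposition* if $r=e+u$ for some idempotent $e\in S$ and some unit $u\in S$ with $u^m=1$; it has a *weakly $m$-torsion clean decomposition* if $r=u+e$ or $r=u-e$ for some such $e$ and $u$. The ring $S$ is *$m$-torsion clean* (respectively, *weakly $m$-torsion clean*) if $m$ is the least element of $\mathbb{N}$ such that every element of $S$ has an $m$-torsion clean (respectively, weakly $m$-torsion clean) decomposition; in particular, no ring is (weakly) $0$-torsion clean. **Theorem.** Let $p$ be an odd prime and $q=p^{\alpha}$ for some integer $\alpha\ge 0$. Let $R$ be an integral domain (commutative, nonzero, without zero divisors, not assumed finite) of characteristic different from $2$ with $|R|>9$, and for $n\in\mathbb{N}$ let $\mathbb{M}_n(R)$ be the ring of $n\times n$ matrices over $R$. Then the following five conditions are equivalent: 1. for every $n\in\mathbb{N}$, the ring $\mathbb{M}_n(R)$ is $(q-1)$-torsion clean; 2. for some $n\in\mathbb{N}$, the ring $\mathbb{M}_n(R)$ is $(q-1)$-torsion clean; 3. for every $n\in\mathbb{N}$,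 the ring $\mathbb{M}_n(R)$ is weakly $(q-1)$-torsion clean; 4. for some $n\in\mathbb{N}$, the ring $\mathbb{M}_n(R)$ is weakly $(q-1)$-torsion clean; 5. $R$ is a finite field and $|R|=q$. -/

import Mathlib

/-- `r` has an `n`-torsion clean decomposition: `r = e + u` with `e` idempotent and
`u` a unit such that `u ^ n = 1`. -/
def HasTorsionCleanDecomp {S : Type*} [Ring S] (n : ℕ) (r : S) : Prop :=
  ∃ e u : S, IsIdempotentElem e ∧ IsUnit u ∧ u ^ n = 1 ∧ r = e + u

/-- `r` has a weakly `n`-torsion clean decomposition: `r = u + e` or `r = u - e` with `e`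
idempotent and `u` a unit such that `u ^ n = 1`. -/
def HasWeaklyTorsionCleanDecomp {S : Type*} [Ring S] (n : ℕ) (r : S) : Prop :=
  ∃ e u : S, IsIdempotentElem e ∧ IsUnit u ∧ u ^ n = 1 ∧ (r = u + e ∨ r = u - e)

/-- `S` is `n`-torsion clean: `n` is the least positive integer such that every element of `S`
has an `n`-torsion clean decomposition. -/
def IsTorsionClean (S : Type*) [Ring S] (n : ℕ) : Prop :=
  IsLeast {m : ℕ | 0 < m ∧ ∀ r : S, HasTorsionCleanDecomp m r} n

/-- `S` is weakly `n`-torsion clean: `n` is the least positive integer such that every element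
of `S` has a weakly `n`-torsion clean decomposition. -/
def IsWeaklyTorsionClean (S : Type*) [Ring S] (n : ℕ) : Prop :=
  IsLeast {m : ℕ | 0 < m ∧ ∀ r : S, HasWeaklyTorsionCleanDecomp m r} n

/-! Let `R` have finite order Q. Both notions of cleanness turn out to have least exponent Q - 1,
which pins down `q`.

Lower bound: a weak decomposition of a scalar matrix `r` forces one of `r`, `r - 1`, `r + 1` to be
an `m`-th root of unity. So three translates of a finite set cover `R`, and `R` is a finite field.
With d = gcd(m, Q - 1), the cover gives Q ≤ 3d, so (Q - 1)/d is 1 or 2. Index 2 would leave no three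
consecutive elements all outside the nonzero squares; a character sum excludes this for Q > 9.

Upper bound: by the module structure theorem over `F[X]`, any endomorphism splits into cyclic
blocks. From each block an explicit idempotent can be subtracted so that the rest is diagonalizable
with nonzero eigenvalues, hence has (Q - 1)-th power 1. -/

/-! ### Quadratic character sums and three consecutive non-squares -/

section QuadraticCharSums

variable {F : Type*} [Field F] [Fintype F] [DecidableEq F]

local notation "χ" => quadraticChar F

lemma quadraticChar_neg_one_mul_self : χ (-1) * χ (-1) = 1 := by
  rw [← map_mul]; simp

lemma quadraticChar_mul_self_eq (a : F) : χ a * χ a = if a = 0 then 0 else 1 := by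
  split_ifs with h
  · simp [h]
  · rw [← sq, quadraticChar_sq_one h]

lemma quadraticChar_abs_le_one (a : F) : |χ a| ≤ 1 := by
  by_cases h : a = 0
  · simp [h]
  · rcases quadraticChar_dichotomy h with h | h <;> simp [h]

/-- The sum of the quadratic character over the values of `(a - t) * (b - t)`. -/
lemma sum_quadraticChar_sub_mul_sub (hF : ringChar F ≠ 2) (a b : F) :
    ∑ t, χ (a - t) * χ (b - t) = (if a = b then (Fintype.card F : ℤ) else 0) - 1 := by
  split_ifs with h
  · subst h
    rw [Fintype.sum_equiv (Equiv.subLeft a) (fun t => χ (a - t) * χ (a - t)) (fun s => χ s * χ s)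
      (fun t => rfl)]
    simp_rw [quadraticChar_mul_self_eq]
    rw [Finset.sum_ite, Finset.sum_const_zero, zero_add, Finset.sum_const, nsmul_eq_mul, mul_one,
      Finset.filter_ne', Finset.card_erase_of_mem (Finset.mem_univ _), Finset.card_univ,
      Nat.cast_sub Fintype.card_pos]
    simp
  · have hab : b - a ≠ 0 := sub_ne_zero.mpr (Ne.symm h)
    have hj := jacobiSum_nontrivial_inv (quadraticChar_ne_one hF)
    rw [(quadraticChar_isQuadratic F).inv, jacobiSum] at hj
    have key : ∑ t, χ (a - t) * χ (b - t) = χ (-1) * ∑ y, χ y * χ (1 - y) := by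
      rw [Finset.mul_sum]
      -- The substitution t = a + (b - a)y turns the correlation into a Jacobi sum of `χ` with its
      -- inverse, which is `χ` itself.
      refine (Fintype.sum_equiv ((Equiv.mulLeft₀ _ hab).trans (Equiv.addLeft a)) _ _ ?_).symm
      intro y
      have h1 : a - ((Equiv.mulLeft₀ _ hab).trans (Equiv.addLeft a)) y = (-1) * (b - a) * y := by
        simp [Equiv.trans_apply]; ring
      have h2 : b - ((Equiv.mulLeft₀ _ hab).trans (Equiv.addLeft a)) y = (b - a) * (1 - y) := by
        simp [Equiv.trans_apply]; ring
      rw [h1, h2, map_mul, map_mul, map_mul]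
      have := quadraticChar_mul_self_eq (b - a)
      rw [if_neg hab] at this
      linear_combination (-(χ (-1) * χ y * χ (1 - y))) * this
    rw [key, hj]
    linear_combination -(quadraticChar_neg_one_mul_self (F := F))

/-- The Jacobsthal sum of the cubic `x ^ 3 - t * x`. -/
def jacobsthalSum (F : Type*) [Field F] [Fintype F] [DecidableEq F] (t : F) : ℤ :=
  ∑ x : F, quadraticChar F x * quadraticChar F (x ^ 2 - t)

lemma jacobsthalSum_sq_sq {c : F} (hc : c ≠ 0) :
    jacobsthalSum F (c ^ 2) ^ 2 = jacobsthalSum F 1 ^ 2 := by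
  have hcc := quadraticChar_mul_self_eq c
  rw [if_neg hc] at hcc
  have : jacobsthalSum F (c ^ 2) = χ c * jacobsthalSum F 1 := by
    rw [jacobsthalSum, jacobsthalSum, Finset.mul_sum]
    refine (Fintype.sum_equiv (Equiv.mulLeft₀ c hc) _ _ ?_).symm
    intro y
    have h2 : (Equiv.mulLeft₀ c hc y) ^ 2 - c ^ 2 = c * c * (y ^ 2 - 1) := by
      simp; ring
    rw [h2, map_mul, map_mul, hcc, Equiv.mulLeft₀_apply, map_mul]
    ring
  rw [this, mul_pow, sq (χ c), hcc, one_mul]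

lemma card_sq_eq_le_two (a : F) : (Finset.univ.filter fun y : F => y ^ 2 = a).card ≤ 2 := by
  have : (Finset.univ.filter fun y : F => y ^ 2 = a) ⊆ (Polynomial.nthRoots 2 a).toFinset := by
    intro y hy
    rw [Multiset.mem_toFinset, Polynomial.mem_nthRoots two_pos]
    exact (Finset.mem_filter.mp hy).2
  exact (Finset.card_le_card this).trans
    ((Multiset.toFinset_card_le _).trans (Polynomial.card_nthRoots 2 a))

/-- Expanding the square and summing over `t` first leaves Q·[x² = y²] - 1. The -1 contributes
nothing because `χ` sums to zero, and each nonzero `x` has at most two partners `y`. -/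
lemma sum_jacobsthalSum_sq_le (hF : ringChar F ≠ 2) :
    ∑ t, jacobsthalSum F t ^ 2 ≤ 2 * Fintype.card F * (Fintype.card F - 1) := by
  set Q : ℤ := (Fintype.card F : ℤ) with hQ
  have h1 : ∑ t, jacobsthalSum F t ^ 2 =
      ∑ x : F, ∑ y : F, χ x * χ y * ((if x ^ 2 = y ^ 2 then Q else 0) - 1) := by
    simp_rw [hQ, ← sum_quadraticChar_sub_mul_sub hF, jacobsthalSum, sq (∑ x : F, _),
      Finset.sum_mul_sum, Finset.mul_sum]
    rw [Finset.sum_comm]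
    refine Finset.sum_congr rfl fun x _ => ?_
    rw [Finset.sum_comm]
    refine Finset.sum_congr rfl fun y _ => Finset.sum_congr rfl fun t _ => by ring
  have h2 : ∑ x : F, ∑ y : F, χ x * χ y * ((if x ^ 2 = y ^ 2 then Q else 0) - 1) =
      ∑ x : F, ∑ y : F, χ x * χ y * (if x ^ 2 = y ^ 2 then Q else 0) := by
    have h0 := quadraticChar_sum_zero (F := F) hF
    have : ∑ x : F, ∑ y : F, χ x * χ y = 0 := by
      rw [← Finset.sum_mul_sum, h0, zero_mul]
    simp_rw [mul_sub, Finset.sum_sub_distrib, mul_one]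
    rw [this, sub_zero]
  have h3 : ∀ x : F, ∑ y : F, χ x * χ y * (if x ^ 2 = y ^ 2 then Q else 0) ≤
      if x = 0 then 0 else 2 * Q := by
    intro x
    split_ifs with hx
    · simp [hx]
    · simp_rw [mul_ite, mul_zero]
      rw [← Finset.sum_filter]
      have : ∀ y ∈ Finset.univ.filter (fun y : F => x ^ 2 = y ^ 2), χ x * χ y * Q ≤ Q := by
        intro y _
        have : χ x * χ y ≤ 1 := by
          rw [← map_mul]; exact (abs_le.mp (quadraticChar_abs_le_one _)).2
        have hQ0 : 0 ≤ Q := by positivity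
        nlinarith
      refine (Finset.sum_le_card_nsmul _ _ _ this).trans ?_
      have hc := card_sq_eq_le_two (x ^ 2)
      simp_rw [eq_comm (b := x ^ 2)] at hc
      have hc' : ((Finset.univ.filter (fun y : F => x ^ 2 = y ^ 2)).card : ℤ) ≤ 2 := by
        exact_mod_cast hc
      rw [nsmul_eq_mul]
      exact mul_le_mul_of_nonneg_right hc' (by positivity)
  rw [h1, h2]
  refine (Finset.sum_le_sum fun x _ => h3 x).trans (le_of_eq ?_)
  rw [Finset.sum_ite, Finset.sum_const_zero, zero_add, Finset.sum_const, nsmul_eq_mul,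
      Finset.filter_ne', Finset.card_erase_of_mem (Finset.mem_univ _), Finset.card_univ,
      Nat.cast_sub Fintype.card_pos]
  push_cast
  ring

/-- An elementary Hasse-type bound: the value at 1 recurs, up to sign, at every nonzero square
parameter, so the second moment controls it. -/
lemma jacobsthalSum_one_sq_le (hF : ringChar F ≠ 2) :
    jacobsthalSum F 1 ^ 2 ≤ 4 * Fintype.card F := by
  have h1 : ∑ c : F, jacobsthalSum F (c ^ 2) ^ 2 ≤ ∑ t : F, 2 * jacobsthalSum F t ^ 2 := by
    rw [← Finset.sum_fiberwise Finset.univ (fun c : F => c ^ 2)]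
    refine Finset.sum_le_sum fun t _ => ?_
    have : ∀ c ∈ Finset.univ.filter (fun c : F => c ^ 2 = t),
        jacobsthalSum F (c ^ 2) ^ 2 = jacobsthalSum F t ^ 2 := by
      intro c hc
      rw [(Finset.mem_filter.mp hc).2]
    rw [Finset.sum_congr rfl this, Finset.sum_const, nsmul_eq_mul]
    exact mul_le_mul_of_nonneg_right (by exact_mod_cast card_sq_eq_le_two t) (sq_nonneg _)
  have h2 : ((Fintype.card F : ℤ) - 1) * jacobsthalSum F 1 ^ 2 ≤
      ∑ c : F, jacobsthalSum F (c ^ 2) ^ 2 := by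
    rw [← Finset.sum_erase_add _ _ (Finset.mem_univ (0 : F)),
      Finset.sum_congr rfl fun c hc => jacobsthalSum_sq_sq (Finset.ne_of_mem_erase hc),
      Finset.sum_const, Finset.card_erase_of_mem (Finset.mem_univ _), Finset.card_univ,
      nsmul_eq_mul, Nat.cast_sub Fintype.card_pos]
    push_cast
    nlinarith [sq_nonneg (jacobsthalSum F (0 ^ 2))]
  rw [← Finset.mul_sum] at h1
  have h3 := sum_jacobsthalSum_sq_le hF
  have hQ : (0 : ℤ) < Fintype.card F - 1 := by
    have : 1 < Fintype.card F := Fintype.one_lt_card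
    have : (1 : ℤ) < Fintype.card F := by exact_mod_cast this
    linarith
  refine le_of_mul_le_mul_left ?_ hQ
  nlinarith

/-- In a finite field of odd order greater than nine there are three consecutive elements none of
which is a nonzero square. -/
lemma exists_quadraticChar_consecutive_ne_one (hF : ringChar F ≠ 2) (hcard : 9 < Fintype.card F) :
    ∃ x : F, χ (x - 1) ≠ 1 ∧ χ x ≠ 1 ∧ χ (x + 1) ≠ 1 := by
  by_contra! hcon
  have hsum : ∑ x : F, (1 - χ (x - 1)) * (1 - χ x) * (1 - χ (x + 1)) = 0 := by
    refine Finset.sum_eq_zero fun x _ => ?_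
    by_cases h1 : χ (x - 1) = 1
    · simp [h1]
    by_cases h2 : χ x = 1
    · simp [h2]
    simp [hcon x h1 h2]
  have two_ne : (2 : F) ≠ 0 := Ring.two_ne_zero hF
  have sq_char : χ (-1) * χ (-1) = 1 := quadraticChar_neg_one_mul_self
  have quad : ∀ a b : F, a ≠ b → ∑ x, χ (x - a) * χ (x - b) = -1 := by
    intro a b hab
    have h := sum_quadraticChar_sub_mul_sub hF a b
    rw [if_neg hab] at h
    rw [← zero_sub, ← h]
    refine Finset.sum_congr rfl fun x _ => ?_
    rw [← neg_sub a x, ← neg_sub b x, ← neg_one_mul (a - x), ← neg_one_mul (b - x), map_mul,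
      map_mul]
    linear_combination (χ (a - x) * χ (b - x)) * sq_char
  have lin : ∀ a : F, ∑ x, χ (x - a) = 0 := by
    intro a
    rw [← quadraticChar_sum_zero hF]
    exact Fintype.sum_equiv (Equiv.subRight a) _ _ fun x => rfl
  have expand : ∀ x : F, (1 - χ (x - 1)) * (1 - χ x) * (1 - χ (x + 1)) =
      1 - χ (x - 1) - χ (x - 0) - χ (x - (-1)) + χ (x - 1) * χ (x - 0) + χ (x - 0) * χ (x - (-1))
        + χ (x - 1) * χ (x - (-1)) - χ x * χ (x ^ 2 - 1) := by
    intro x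
    have : x ^ 2 - 1 = (x - 1) * (x + 1) := by ring
    rw [this, map_mul, sub_zero, sub_neg_eq_add]
    ring
  simp_rw [expand, Finset.sum_sub_distrib, Finset.sum_add_distrib, Finset.sum_sub_distrib] at hsum
  rw [lin, lin, lin, quad _ _ one_ne_zero, quad _ _ (by simp), quad 1 (-1)] at hsum
  · have hS := jacobsthalSum_one_sq_le hF
    rw [← jacobsthalSum, Finset.sum_const, Finset.card_univ, nsmul_eq_mul, mul_one] at hsum
    -- Then (Q - 3)² ≤ 4Q, that is (Q - 1)(Q - 9) ≤ 0, which is where the bound 9 comes from.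
    have hS1 : jacobsthalSum F 1 = Fintype.card F - 3 := by linarith
    rw [hS1] at hS
    have : (9 : ℤ) < Fintype.card F := by exact_mod_cast hcard
    nlinarith
  · intro h
    apply two_ne
    linear_combination h

end QuadraticCharSums

/-! ### Covering a finite field by translated roots of unity -/

/-- If every element of a finite field of odd order greater than nine is an `m`-th root of unity
up to adding `0`, `1` or `-1`, then the order of the unit group divides `m`. -/
lemma card_sub_one_dvd_of_cover {F : Type*} [Field F] [Fintype F] (hF : ringChar F ≠ 2)
    (hcard : 9 < Fintype.card F) {m : ℕ} (hm : 0 < m)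
    (h : ∀ x : F, x ^ m = 1 ∨ (x - 1) ^ m = 1 ∨ (x + 1) ^ m = 1) :
    Fintype.card F - 1 ∣ m := by
  classical
  set Q := Fintype.card F with hQ
  set d := Nat.gcd m (Q - 1) with hd
  have hroot : ∀ x : F, x ^ m = 1 → x ^ d = 1 := by
    intro x hx
    have hx0 : x ≠ 0 := by rintro rfl; simp [hm.ne'] at hx
    exact pow_gcd_eq_one.mpr ⟨hx, FiniteField.pow_card_sub_one_eq_one x hx0⟩
  have hdpos : 0 < d := Nat.gcd_pos_of_pos_left _ hm
  set U : Finset F := Finset.univ.filter fun x => x ^ d = 1 with hU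
  have hUcard : U.card ≤ d := by
    have : U ⊆ (Polynomial.nthRoots d (1 : F)).toFinset := by
      intro y hy
      simp only [hU, Finset.mem_filter, Finset.mem_univ, true_and] at hy
      rwa [Multiset.mem_toFinset, Polynomial.mem_nthRoots hdpos]
    exact (Finset.card_le_card this).trans
      ((Multiset.toFinset_card_le _).trans (Polynomial.card_nthRoots d 1))
  have hcover : (Finset.univ : Finset F) ⊆ U ∪ U.image (· + 1) ∪ U.image (· - 1) := by
    intro x _
    simp only [Finset.mem_union, Finset.mem_image, hU, Finset.mem_filter, Finset.mem_univ,
      true_and]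
    rcases h x with h | h | h
    · exact Or.inl (Or.inl (hroot _ h))
    · exact Or.inl (Or.inr ⟨_, hroot _ h, by ring⟩)
    · exact Or.inr ⟨_, hroot _ h, by ring⟩
  have hle : Q ≤ 3 * d := by
    have h1 := Finset.card_le_card hcover
    have h2 := Finset.card_union_le (U ∪ U.image (· + 1)) (U.image (· - 1))
    have h3 := Finset.card_union_le U (U.image (· + 1))
    have h4 : (U.image (· + 1)).card ≤ U.card := Finset.card_image_le
    have h5 : (U.image (· - 1)).card ≤ U.card := Finset.card_image_le
    rw [Finset.card_univ] at h1
    omega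
  obtain ⟨k, hk⟩ : d ∣ Q - 1 := Nat.gcd_dvd_right _ _
  have hk3 : k < 3 := by
    by_contra! hk'
    have : d * 3 ≤ d * k := Nat.mul_le_mul_left _ hk'
    omega
  interval_cases k
  · omega
  · have hdQ : d = Q - 1 := by omega
    exact hdQ ▸ Nat.gcd_dvd_left m (Q - 1)
  · exfalso
    have hd2 : d = Q / 2 := by
      have := FiniteField.odd_card_of_char_ne_two hF
      omega
    obtain ⟨x, hx1, hx2, hx3⟩ := exists_quadraticChar_consecutive_ne_one hF hcard
    have hone : ∀ y : F, y ^ m = 1 → quadraticChar F y = 1 := by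
      intro y hy
      have hy0 : y ≠ 0 := by rintro rfl; simp [hm.ne'] at hy
      rw [quadraticChar_eq_pow_of_char_ne_two hF hy0, if_pos]
      rw [← hQ, ← hd2, hroot y hy]
    rcases h x with h | h | h
    · exact hx2 (hone _ h)
    · exact hx1 (hone _ h)
    · exact hx3 (hone _ h)
-- Splitting a cyclic block into an idempotent and a diagonalizable part
open Polynomial in
/-- An endomorphism over a finite field is annihilated by `X ^ (q - 1) - 1` as soon as, up to one
exceptional nonzero eigenvalue, its eigenvectors for nonzero eigenvalues span the space. -/
lemma Module.End.pow_card_sub_one_eq_one {F V ι : Type*} [Field F] [Fintype F] [AddCommGroup V]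
    [Module F V] (b : Module.Basis ι F V) (u : Module.End F V) {β : F} (hβ : β ≠ 0)
    (hb : ∀ i, b i ∈ Submodule.span F {z | ∃ t : F, t ≠ 0 ∧ t ≠ β ∧ u z = t • z} ∨
      u (b i) - β • b i ∈ Submodule.span F {z | ∃ t : F, t ≠ 0 ∧ t ≠ β ∧ u z = t • z}) :
    u ^ (Fintype.card F - 1) = 1 := by
  obtain ⟨P, hP⟩ : (X - C β) ∣ (X ^ (Fintype.card F - 1) - 1 : F[X]) := by
    rw [dvd_iff_isRoot]
    simp [FiniteField.pow_card_sub_one_eq_one β hβ]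
  have hS : Submodule.span F {z | ∃ t : F, t ≠ 0 ∧ t ≠ β ∧ u z = t • z} ≤
      LinearMap.ker (aeval u P) := by
    rw [Submodule.span_le]
    rintro z ⟨t, ht0, htβ, hz⟩
    by_cases hz0 : z = 0
    · simp [hz0]
    have hev : u.HasEigenvector t z := ⟨Module.End.mem_eigenspace_iff.mpr hz, hz0⟩
    have hPt : P.eval t = 0 := by
      have := congrArg (eval t) hP
      simp only [eval_sub, eval_pow, eval_X, eval_one, eval_mul, eval_C,
        FiniteField.pow_card_sub_one_eq_one t ht0, sub_self] at this
      exact (mul_eq_zero.mp this.symm).resolve_left (sub_ne_zero.mpr htβ)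
    rw [SetLike.mem_coe, LinearMap.mem_ker, Module.End.aeval_apply_of_hasEigenvector hev, hPt,
      zero_smul]
  have hfac : u ^ (Fintype.card F - 1) - 1 = (u - algebraMap F _ β) * aeval u P := by
    have := congrArg (aeval u) hP
    simpa using this
  have hfac' : u ^ (Fintype.card F - 1) - 1 = aeval u P * (u - algebraMap F _ β) := by
    have := congrArg (aeval u) (hP.trans (mul_comm _ _))
    simpa using this
  rw [← sub_eq_zero]
  refine b.ext fun i => ?_
  rcases hb i with h | h
  · have h0 : aeval u P (b i) = 0 := hS h
    rw [hfac, Module.End.mul_apply, h0, map_zero, LinearMap.zero_apply]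
  · have h0 : aeval u P (u (b i) - β • b i) = 0 := hS h
    rw [hfac', Module.End.mul_apply, LinearMap.sub_apply, Module.algebraMap_end_apply, h0,
      LinearMap.zero_apply]

lemma exists_avoiding_six {F : Type*} [Field F] [Fintype F] (hcard : 6 < Fintype.card F)
    (a₁ a₂ a₃ a₄ a₅ a₆ : F) :
    ∃ d : F, d ≠ a₁ ∧ d ≠ a₂ ∧ d ≠ a₃ ∧ d ≠ a₄ ∧ d ≠ a₅ ∧ d ≠ a₆ := by
  classical
  by_contra! hcon
  have hsub : (Finset.univ : Finset F) ⊆ {a₁, a₂, a₃, a₄, a₅, a₆} := by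
    intro d _
    simp only [Finset.mem_insert, Finset.mem_singleton]
    by_contra! h
    exact h.2.2.2.2.2 (hcon d h.1 h.2.1 h.2.2.1 h.2.2.2.1 h.2.2.2.2.1)
  have h1 := Finset.card_le_card hsub
  have h2 := Finset.card_le_six (a := a₁) (b := a₂) (c := a₃) (d := a₄) (e := a₅) (f := a₆)
  rw [Finset.card_univ] at h1
  omega

/-- If `g` shifts a basis of length `m + 2`, then `g + 2` is the sum of an idempotent and an
endomorphism which is diagonalizable with nonzero eigenvalues. -/
lemma exists_idempotent_of_shift_add_two {F V : Type*} [Field F] [Fintype F] [AddCommGroup V]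
    [Module F V] (h2 : (2 : F) ≠ 0) (hcard : 6 < Fintype.card F) {m : ℕ}
    (b : Module.Basis (Fin (m + 2)) F V) (g : Module.End F V)
    (hg : ∀ (i : Fin (m + 2)) (h : (i : ℕ) + 1 < m + 2), g (b i) = b ⟨i + 1, h⟩) :
    ∃ e : Module.End F V, IsIdempotentElem e ∧ (g + algebraMap F _ 2 - e) ^ (Fintype.card F - 1) = 1 := by
  set c : F := b.repr (g (b (Fin.last (m + 1)))) (Fin.last (m + 1)) with hc
  -- The eigenvalues of the difference will be 1, 2, `d` and β = 3 + c - d. The excluded values keep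
  -- `d` off 0 and 2, and β off 0, 1, 2 and `d`.
  obtain ⟨d, hd0, hd2, hd3, hd4, hd5, hd6⟩ :=
    exists_avoiding_six hcard 0 2 (3 + c) (2 + c) (1 + c) ((3 + c) / 2)
  set w : ℕ → V := fun j => if h : j < m + 2 then b ⟨j, h⟩ else 0 with hw
  have hbw : ∀ i : Fin (m + 2), b i = w i := fun i => by simp [hw]
  set δ : ℕ → F := fun j => if j = m then d else 1 with hδ
  have hδ0 : ∀ j, δ j ≠ 0 := fun j => by simp only [hδ]; split_ifs <;> simp [hd0]
  have hδ2 : ∀ j, δ j ≠ 2 := fun j => by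
    simp only [hδ]; split_ifs
    · exact hd2
    · intro h
      apply one_ne_zero (α := F)
      linear_combination -h
  set E : ℕ → V := fun j => (2 - δ j) • w j + w (j + 1) with hE
  -- The `E j` with `m + j` even span the range of `e`. The coefficients make `e` fix each `E j` and
  -- make `w j` an eigenvector of `g + 2 - e` with eigenvalue `δ j`.
  set e : Module.End F V := b.constr F fun i =>
    if (m + (i : ℕ)) % 2 = 0 then E i else (δ (i - 1) - 1) • E (i - 1) with he
  have he_first : ∀ j, j ≤ m → (m + j) % 2 = 0 → e (w j) = E j := by
    intro j hj hpar
    have := b.constr_basis F (fun i : Fin (m + 2) =>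
      if (m + (i : ℕ)) % 2 = 0 then E i else (δ (i - 1) - 1) • E (i - 1)) ⟨j, by omega⟩
    rw [← he, hbw] at this
    simpa [hpar] using this
  have he_second : ∀ j, j ≤ m + 1 → (m + j) % 2 = 1 → e (w j) = (δ (j - 1) - 1) • E (j - 1) := by
    intro j hj hpar
    have := b.constr_basis F (fun i : Fin (m + 2) =>
      if (m + (i : ℕ)) % 2 = 0 then E i else (δ (i - 1) - 1) • E (i - 1)) ⟨j, by omega⟩
    rw [← he, hbw] at this
    simpa [hpar] using this
  have he_zero : ∀ j, j ≤ m → (m + j) % 2 = 1 → e (w j) = 0 := by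
    intro j hj hpar
    -- For `j = 0` the truncated `j - 1` is 0, but then `m` is odd, so `δ` is still 1 there.
    have hjm : j - 1 ≠ m := by omega
    rw [he_second j (by omega) hpar]
    simp [hδ, hjm]
  have heE : ∀ j, j ≤ m → (m + j) % 2 = 0 → e (E j) = E j := by
    intro j hj hpar
    have h1 : e (E j) = (2 - δ j) • e (w j) + e (w (j + 1)) := by simp [hE]
    rw [h1, he_first j hj hpar, he_second (j + 1) (by omega) (by omega), Nat.add_sub_cancel]
    module
  have hidem : IsIdempotentElem e := by
    refine b.ext fun i => ?_
    have hi := i.isLt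
    rw [Module.End.mul_apply, hbw]
    rcases Nat.mod_two_eq_zero_or_one (m + i) with hpar | hpar
    · have him : (i : ℕ) ≤ m := by omega
      rw [he_first _ him hpar, heE _ him hpar]
    · by_cases him : (i : ℕ) ≤ m
      · rw [he_zero _ him hpar, map_zero]
      · rw [he_second _ (by omega) hpar, map_smul, heE _ (by omega) (by omega)]
  have hgw : ∀ j, j ≤ m → g (w j) = w (j + 1) := by
    intro j hj
    have := hg ⟨j, by omega⟩ (by simp; omega)
    rwa [hbw, hbw] at this
  refine ⟨e, hidem, ?_⟩
  have hu : ∀ v, (g + algebraMap F _ 2 - e) v = g v + (2 : F) • v - e v := by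
    intro v
    rw [LinearMap.sub_apply, LinearMap.add_apply, Module.algebraMap_end_apply]
  set β : F := 3 + c - d with hβdef
  have hβ0 : β ≠ 0 := fun h => hd3 (by linear_combination -h)
  have hβ1 : 1 ≠ β := fun h => hd4 (by linear_combination h)
  have hβ2 : 2 ≠ β := fun h => hd5 (by linear_combination h)
  have hβd : d ≠ β := fun h => hd6 (by
    rw [eq_div_iff h2]; linear_combination h)
  have hδβ : ∀ j, δ j ≠ β := fun j => by
    simp only [hδ]; split_ifs
    · exact hβd
    · exact hβ1
  set S := Submodule.span F {z | ∃ t : F, t ≠ 0 ∧ t ≠ β ∧ (g + algebraMap F _ 2 - e) z = t • z} with hS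
  have hS_first : ∀ j, j ≤ m → (m + j) % 2 = 0 → w j ∈ S := by
    intro j hj hpar
    refine Submodule.subset_span ⟨δ j, hδ0 j, hδβ j, ?_⟩
    rw [hu, hgw j hj, he_first j hj hpar]
    simp only [hE]
    module
  have hwS : ∀ j, j ≤ m → w j ∈ S := by
    intro j hj
    rcases Nat.mod_two_eq_zero_or_one (m + j) with hpar | hpar
    · exact hS_first j hj hpar
    · have hj1 : j + 1 ≤ m := by omega
      have hsub : δ (j + 1) - 2 ≠ 0 := sub_ne_zero.mpr (hδ2 _)
      -- Here `e` kills `w j`, so it maps to `2 • w j + w (j + 1)`; as `δ (j + 1) ≠ 2`, this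
      -- correction gives an eigenvector for 2.
      have hz : w j - (δ (j + 1) - 2)⁻¹ • w (j + 1) ∈ S := by
        refine Submodule.subset_span ⟨2, h2, hβ2, ?_⟩
        rw [hu, map_sub, map_sub, map_smul, map_smul, hgw j hj, hgw _ hj1, he_zero j hj hpar,
          he_first (j + 1) hj1 (by omega)]
        simp only [hE]
        match_scalars <;> field_simp <;> ring
      have := S.add_mem hz (S.smul_mem (δ (j + 1) - 2)⁻¹ (hS_first (j + 1) hj1 (by omega)))
      rwa [sub_add_cancel] at this
  refine Module.End.pow_card_sub_one_eq_one b _ hβ0 fun i => ?_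
  by_cases hi : (i : ℕ) ≤ m
  · left
    rw [hbw]
    exact hwS _ hi
  · right
    have hi' : i = Fin.last (m + 1) := by
      ext; simp; omega
    have hlast : g (w (m + 1)) - c • w (m + 1) ∈ S := by
      have h1 := b.sum_repr (g (b (Fin.last (m + 1))))
      rw [Fin.sum_univ_castSucc, ← hc] at h1
      have h3 : b (Fin.last (m + 1)) = w (m + 1) := hbw _
      rw [h3] at h1
      rw [← h1, add_sub_cancel_right]
      refine S.sum_mem fun k _ => S.smul_mem _ ?_
      rw [hbw]
      exact hwS _ (by simp; omega)
    have hδm : δ m = d := by simp [hδ]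
    have hcomb : (g + algebraMap F _ 2 - e) (b i) - β • b i =
        (g (w (m + 1)) - c • w (m + 1)) - ((d - 1) * (2 - d)) • w m := by
      rw [hi', hbw, hu, Fin.val_last, he_second (m + 1) le_rfl (by omega), Nat.add_sub_cancel, hδm]
      simp only [hE, hδm, hβdef]
      module
    rw [hcomb]
    exact S.sub_mem hlast (S.smul_mem _ (hwS m le_rfl))

lemma exists_idempotent_of_cyclic_add_two {F V : Type*} [Field F] [Fintype F] [AddCommGroup V]
    [Module F V] (h2 : (2 : F) ≠ 0) (hcard : 6 < Fintype.card F) {n : ℕ}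
    (b : Module.Basis (Fin n) F V) (g : Module.End F V)
    (hg : ∀ (i : Fin n) (h : (i : ℕ) + 1 < n), g (b i) = b ⟨i + 1, h⟩) :
    ∃ e : Module.End F V, IsIdempotentElem e ∧ (g + algebraMap F _ 2 - e) ^ (Fintype.card F - 1) = 1 := by
  match n, b, hg with
  | 0, b, _ => exact ⟨0, IsIdempotentElem.zero, b.ext fun i => i.elim0⟩
  | 1, b, _ =>
    obtain ⟨c, hc⟩ : ∃ c : F, g = algebraMap F _ c := by
      refine ⟨b.repr (g (b 0)) 0, b.ext fun i => ?_⟩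
      have := b.sum_repr (g (b 0))
      rw [Fin.sum_univ_one] at this
      rw [Subsingleton.elim i 0, Module.algebraMap_end_apply, this]
    have hpow : ∀ t : F, t ≠ 0 →
        (algebraMap F (Module.End F V) t) ^ (Fintype.card F - 1) = 1 := by
      intro t ht
      rw [← map_pow, FiniteField.pow_card_sub_one_eq_one t ht, map_one]
    by_cases h0 : c + 2 = 0
    · refine ⟨1, IsIdempotentElem.one, ?_⟩
      have : g + algebraMap F _ 2 - 1 = algebraMap F _ (c + 2 - 1) := by
        rw [hc, map_sub, map_add, map_one]
      rw [this, h0, zero_sub, hpow _ (by simp)]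
    · refine ⟨0, IsIdempotentElem.zero, ?_⟩
      rw [sub_zero, hc, ← map_add, hpow _ h0]
  | m + 2, b, hg => exact exists_idempotent_of_shift_add_two h2 hcard b g hg
-- Assembling cyclic blocks
lemma exists_idempotent_of_linearEquiv_pi {F V ι : Type*} [Field F] [AddCommGroup V]
    [Module F V] {W : ι → Type*} [∀ i, AddCommGroup (W i)] [∀ i, Module F (W i)] (m : ℕ)
    (φ : V ≃ₗ[F] ∀ i, W i) (f : Module.End F V) (g : ∀ i, Module.End F (W i))
    (hfg : ∀ v i, φ (f v) i = g i (φ v i))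
    (h : ∀ i, ∃ e : Module.End F (W i), IsIdempotentElem e ∧ (g i - e) ^ m = 1) :
    ∃ e : Module.End F V, IsIdempotentElem e ∧ (f - e) ^ m = 1 := by
  choose e he hem using h
  set e' : Module.End F V := φ.symm.conj (LinearMap.pi fun i => e i ∘ₗ LinearMap.proj i) with he'
  have happ : ∀ v i, φ (e' v) i = e i (φ v i) := by
    intro v i
    simp [he', LinearEquiv.conj_apply]
  have hpow : ∀ (k : ℕ) v i, φ (((f - e') ^ k) v) i = ((g i - e i) ^ k) (φ v i) := by
    intro k
    induction k with
    | zero => intro v i; simp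
    | succ k ih =>
      intro v i
      rw [pow_succ, pow_succ, Module.End.mul_apply, Module.End.mul_apply, ih, LinearMap.sub_apply,
        LinearMap.sub_apply, map_sub, Pi.sub_apply, hfg, happ]
  refine ⟨e', ?_, ?_⟩
  · refine LinearMap.ext fun v => φ.injective (funext fun i => ?_)
    rw [Module.End.mul_apply, happ, happ, ← Module.End.mul_apply, (he i).eq]
  · refine LinearMap.ext fun v => φ.injective (funext fun i => ?_)
    rw [hpow, hem, Module.End.one_apply, Module.End.one_apply]

open Polynomial in
-- Multiplication by `X` shifts the power basis of the quotient, so the cyclic construction applies.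
lemma exists_idempotent_quotient_add_two {F : Type*} [Field F] [Fintype F] (h2 : (2 : F) ≠ 0)
    (hcard : 6 < Fintype.card F) {p : F[X]} (hp : p ≠ 0) :
    ∃ e : Module.End F (F[X] ⧸ Ideal.span {p}), IsIdempotentElem e ∧
      (Algebra.lsmul F F (F[X] ⧸ Ideal.span {p}) (X : F[X]) + algebraMap F _ 2 - e) ^
        (Fintype.card F - 1) = 1 := by
  refine exists_idempotent_of_cyclic_add_two h2 hcard (AdjoinRoot.powerBasis hp).basis _ ?_
  intro i h
  rw [PowerBasis.basis_eq_pow, PowerBasis.basis_eq_pow, pow_succ']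
  rfl

open Polynomial in
/-- Every endomorphism of a finite-dimensional space over a large finite field of odd
characteristic is the sum of an idempotent and a diagonalizable automorphism. -/
lemma Module.End.exists_idempotent_sub_pow_eq_one {F V : Type*} [Field F] [Fintype F]
    [AddCommGroup V] [Module F V] [FiniteDimensional F V] (h2 : (2 : F) ≠ 0)
    (hcard : 6 < Fintype.card F) (f : Module.End F V) :
    ∃ e : Module.End F V, IsIdempotentElem e ∧ (f - e) ^ (Fintype.card F - 1) = 1 := by
  -- Decomposing `f - 2` rather than `f` puts 2 on the diagonal of a shift, so subtracting an
  -- idempotent can leave the distinct nonzero values 1 and 2.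
  set g : Module.End F V := f - algebraMap F _ 2 with hg
  obtain ⟨ι, _, p, hp, k, ⟨ψ⟩⟩ := Module.equiv_directSum_of_isTorsion
    (Module.AEval.isTorsion_of_finiteDimensional F V g)
  classical
  let φ : V ≃ₗ[F] ∀ i, F[X] ⧸ Ideal.span {p i ^ k i} :=
    (Module.AEval'.of g).trans ((ψ.restrictScalars F).trans
      (DirectSum.linearEquivFunOnFintype F ι _))
  refine exists_idempotent_of_linearEquiv_pi _ φ f
    (fun i => Algebra.lsmul F F _ (X : F[X]) + algebraMap F _ 2) ?_ fun i =>
      exists_idempotent_quotient_add_two h2 hcard (pow_ne_zero _ (hp i).ne_zero)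
  intro v i
  have hv : f v = g v + (2 : F) • v := by simp [hg]
  have hX : φ (g v) i = (X : F[X]) • φ v i := by
    have h1 : Module.AEval'.of g (g v) = (X : F[X]) • Module.AEval'.of g v :=
      (Module.AEval'.X_smul_of g v).symm
    have h3 : ψ (Module.AEval'.of g (g v)) = (X : F[X]) • ψ (Module.AEval'.of g v) := by
      rw [h1, map_smul]
    exact congrArg (fun z => z i) h3
  rw [hv, map_add, map_smul, Pi.add_apply, Pi.smul_apply, hX, LinearMap.add_apply,
    Module.algebraMap_end_apply, Algebra.lsmul_coe]

lemma Matrix.hasTorsionCleanDecomp_card_sub_one {F : Type*} [Field F] [Fintype F]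
    (h2 : (2 : F) ≠ 0) (hcard : 6 < Fintype.card F) {n : ℕ} (A : Matrix (Fin n) (Fin n) F) :
    HasTorsionCleanDecomp (Fintype.card F - 1) A := by
  obtain ⟨e, he, hu⟩ := Module.End.exists_idempotent_sub_pow_eq_one h2 hcard
    (Matrix.toLinAlgEquiv' A)
  have hpos : Fintype.card F - 1 ≠ 0 := by omega
  have hu' : (A - Matrix.toLinAlgEquiv'.symm e) ^ (Fintype.card F - 1) = 1 := by
    apply Matrix.toLinAlgEquiv'.injective
    rw [map_pow, map_sub, AlgEquiv.apply_symm_apply, hu, map_one]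
  refine ⟨Matrix.toLinAlgEquiv'.symm e, A - Matrix.toLinAlgEquiv'.symm e, ?_,
    IsUnit.of_pow_eq_one hu' hpos, hu', by abel⟩
  exact he.map _

/-! ### Scalar matrices and the least exponent -/

lemma HasTorsionCleanDecomp.hasWeaklyTorsionCleanDecomp {S : Type*} [Ring S] {m : ℕ} {r : S}
    (h : HasTorsionCleanDecomp m r) : HasWeaklyTorsionCleanDecomp m r := by
  obtain ⟨e, u, he, hu, hum, rfl⟩ := h
  exact ⟨e, u, he, hu, hum, Or.inl (add_comm _ _)⟩

/-- A scalar matrix with a weakly torsion clean decomposition is a root of unity up to adding `0`,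
`1` or `-1`. -/
lemma HasWeaklyTorsionCleanDecomp.pow_eq_one_of_scalar {R ι : Type*} [CommRing R] [IsDomain R]
    [Fintype ι] [DecidableEq ι] [Nonempty ι] {m : ℕ} {r : R}
    (h : HasWeaklyTorsionCleanDecomp m (algebraMap R (Matrix ι ι R) r)) :
    r ^ m = 1 ∨ (r - 1) ^ m = 1 ∨ (r + 1) ^ m = 1 := by
  obtain ⟨e, u, he, -, hum, h⟩ := h
  by_cases h1 : e = 1
  · right
    have hinj : Function.Injective (algebraMap R (Matrix ι ι R)) :=
      FaithfulSMul.algebraMap_injective _ _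
    subst h1
    rcases h with h | h
    · left
      apply hinj
      rw [map_pow, map_sub, map_one, h, add_sub_cancel_right, hum]
    · right
      apply hinj
      rw [map_pow, map_add, map_one, h, sub_add_cancel, hum]
  · left
    -- On the nonzero range of `1 - e`, `u` acts as the scalar `r`; torsion-freeness then gives `r ^
    -- m = 1`.
    have hk : (1 - e) ≠ 0 := sub_ne_zero.mpr (Ne.symm h1)
    have hek : e * (1 - e) = 0 := by rw [mul_sub, mul_one, he.eq, sub_self]
    have huk : u * (1 - e) = algebraMap R _ r * (1 - e) := by
      rcases h with h | h
      · rw [h, add_mul, hek, add_zero]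
      · rw [h, sub_mul, hek, sub_zero]
    have hpow : ∀ k : ℕ, u ^ k * (1 - e) = algebraMap R _ (r ^ k) * (1 - e) := by
      intro k
      induction k with
      | zero => simp
      | succ k ih =>
        rw [pow_succ, mul_assoc, huk, ← mul_assoc, ← Algebra.commutes, mul_assoc, ih, ← mul_assoc,
          ← map_mul, pow_succ']
    have hzero : (r ^ m - 1) • (1 - e) = 0 := by
      rw [Algebra.smul_def, map_sub, sub_mul, ← hpow, hum, map_one, sub_self]
    exact sub_eq_zero.mp ((smul_eq_zero.mp hzero).resolve_right hk)

lemma finite_of_cover {R : Type*} [CommRing R] [IsDomain R] {m : ℕ} (hm : 0 < m)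
    (h : ∀ x : R, x ^ m = 1 ∨ (x - 1) ^ m = 1 ∨ (x + 1) ^ m = 1) : Finite R := by
  classical
  have hfin : {x : R | x ^ m = 1}.Finite := by
    refine ((Polynomial.nthRoots m (1 : R)).toFinset.finite_toSet).subset fun x hx => ?_
    rw [Finset.mem_coe, Multiset.mem_toFinset, Polynomial.mem_nthRoots hm]
    exact hx
  rw [← Set.finite_univ_iff]
  refine ((hfin.union ((hfin.preimage (f := fun x => x - 1) ?_).union
    (hfin.preimage (f := fun x => x + 1) ?_)))).subset fun x _ => h x
  · exact (sub_left_injective).injOn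
  · exact (add_left_injective _).injOn

lemma nat_card_sub_one_dvd_of_forall_hasWeaklyTorsionCleanDecomp {R ι : Type*} [CommRing R]
    [IsDomain R] [Finite R] [Fintype ι] [DecidableEq ι] [Nonempty ι] (hchar : ringChar R ≠ 2)
    (hcard : 9 < Nat.card R) {m : ℕ} (hm : 0 < m)
    (h : ∀ A : Matrix ι ι R, HasWeaklyTorsionCleanDecomp m A) : Nat.card R - 1 ∣ m := by
  classical
  let := Fintype.ofFinite R
  let : Field R := Fintype.fieldOfDomain R
  rw [Nat.card_eq_fintype_card] at hcard ⊢
  exact card_sub_one_dvd_of_cover hchar hcard hm fun x => (h _).pow_eq_one_of_scalar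

lemma Matrix.hasTorsionCleanDecomp_nat_card_sub_one {R : Type*} [CommRing R] [IsDomain R]
    [Finite R] (hchar : ringChar R ≠ 2) (hcard : 9 < Nat.card R) {n : ℕ}
    (A : Matrix (Fin n) (Fin n) R) : HasTorsionCleanDecomp (Nat.card R - 1) A := by
  classical
  let := Fintype.ofFinite R
  let : Field R := Fintype.fieldOfDomain R
  rw [Nat.card_eq_fintype_card] at hcard ⊢
  exact Matrix.hasTorsionCleanDecomp_card_sub_one (Ring.two_ne_zero hchar) (by omega) A

/-- A common form of the two cleanness conditions: `m` is the least positive exponent for a notion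
of decomposition lying between the clean and the weakly clean one. -/
lemma isLeast_iff_nat_card_sub_one {R : Type*} [CommRing R] [IsDomain R] (hchar : ringChar R ≠ 2)
    (hcard : 9 < Cardinal.mk R) {n : ℕ} (hn : 0 < n)
    (D : ℕ → Matrix (Fin n) (Fin n) R → Prop)
    (hD : ∀ m A, HasTorsionCleanDecomp m A → D m A)
    (hD' : ∀ m A, D m A → HasWeaklyTorsionCleanDecomp m A) (m : ℕ) :
    IsLeast {m : ℕ | 0 < m ∧ ∀ A, D m A} m ↔ Finite R ∧ Nat.card R - 1 = m := by
  have : Nonempty (Fin n) := ⟨⟨0, hn⟩⟩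
  have hnat : Finite R → 9 < Nat.card R := by
    intro _
    rw [← Nat.cast_card] at hcard
    exact_mod_cast hcard
  constructor
  · rintro ⟨⟨hm, h⟩, hleast⟩
    have hfin : Finite R := finite_of_cover hm fun x => (hD' _ _ (h _)).pow_eq_one_of_scalar
    have h9 := hnat hfin
    have hdvd := nat_card_sub_one_dvd_of_forall_hasWeaklyTorsionCleanDecomp hchar h9 hm
      fun A => hD' _ _ (h A)
    refine ⟨hfin, le_antisymm (Nat.le_of_dvd hm hdvd) (hleast ⟨by omega, fun A => hD _ _ ?_⟩)⟩
    exact Matrix.hasTorsionCleanDecomp_nat_card_sub_one hchar h9 A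
  · rintro ⟨hfin, rfl⟩
    have h9 := hnat hfin
    refine ⟨⟨by omega, fun A => hD _ _
      (Matrix.hasTorsionCleanDecomp_nat_card_sub_one hchar h9 A)⟩, ?_⟩
    rintro m ⟨hm, h⟩
    exact Nat.le_of_dvd hm (nat_card_sub_one_dvd_of_forall_hasWeaklyTorsionCleanDecomp hchar h9 hm
      fun A => hD' _ _ (h A))

theorem theorem1p7 (p α q : ℕ) (hp : p.Prime) (hp_odd : Odd p) (hq : q = p ^ α)
    (R : Type*) [CommRing R] [IsDomain R] (hchar : ringChar R ≠ 2)
    (hcard : 9 < Cardinal.mk R) :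
    List.TFAE [
      ∀ n : ℕ, 0 < n → IsTorsionClean (Matrix (Fin n) (Fin n) R) (q - 1),
      ∃ n : ℕ, 0 < n ∧ IsTorsionClean (Matrix (Fin n) (Fin n) R) (q - 1),
      ∀ n : ℕ, 0 < n → IsWeaklyTorsionClean (Matrix (Fin n) (Fin n) R) (q - 1),
      ∃ n : ℕ, 0 < n ∧ IsWeaklyTorsionClean (Matrix (Fin n) (Fin n) R) (q - 1),
      IsField R ∧ Finite R ∧ Nat.card R = q] := by
  -- Positivity lets the truncated equality `Nat.card R - 1 = q - 1` recover `Nat.card R = q`.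
  have hq0 : 0 < q := hq ▸ pow_pos hp.pos α
  have hfield : (Finite R ∧ Nat.card R - 1 = q - 1) ↔ IsField R ∧ Finite R ∧ Nat.card R = q := by
    constructor
    · rintro ⟨hfin, h⟩
      have : 0 < Nat.card R := Nat.card_pos
      exact ⟨Finite.isField_of_domain R, hfin, by omega⟩
    · rintro ⟨-, hfin, rfl⟩
      exact ⟨hfin, rfl⟩
  have clean : ∀ n : ℕ, 0 < n → (IsTorsionClean (Matrix (Fin n) (Fin n) R) (q - 1) ↔
      IsField R ∧ Finite R ∧ Nat.card R = q) := fun n hn =>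
    (isLeast_iff_nat_card_sub_one hchar hcard hn HasTorsionCleanDecomp (fun _ _ h => h)
      (fun _ _ h => h.hasWeaklyTorsionCleanDecomp) _).trans hfield
  have weak : ∀ n : ℕ, 0 < n → (IsWeaklyTorsionClean (Matrix (Fin n) (Fin n) R) (q - 1) ↔
      IsField R ∧ Finite R ∧ Nat.card R = q) := fun n hn =>
    (isLeast_iff_nat_card_sub_one hchar hcard hn HasWeaklyTorsionCleanDecomp
      (fun _ _ h => h.hasWeaklyTorsionCleanDecomp) (fun _ _ h => h) _).trans hfield
  tfae_have 1 → 2 := fun h => ⟨1, one_pos, h 1 one_pos⟩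
  tfae_have 2 → 5 := fun ⟨n, hn, h⟩ => (clean n hn).mp h
  tfae_have 5 → 1 := fun h n hn => (clean n hn).mpr h
  tfae_have 5 → 3 := fun h n hn => (weak n hn).mpr h
  tfae_have 3 → 4 := fun h => ⟨1, one_pos, h 1 one_pos⟩
  tfae_have 4 → 5 := fun ⟨n, hn, h⟩ => (weak n hn).mp h
  tfae_finish
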